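/- A groupoid $\mathscr G$ is a small category in which every arrow is invertible; we identify it with its set of arrows, write $\boldsymbol d(g)=g^{-1}g$ and $\boldsymbol r(g)=gg^{-1}$ for source and range, and let $\mathscr G^{(0)}=\{gg^{-1}: g\in\mathscr G\}$ be the unit space. A topological groupoid is a groupoid with a topology on $\mathscr G$ making multiplication and inversion continuous; $\mathscr G^{(0)}$ carries the subspace topology. It is *ample* if $\mathscr G^{(0)}$ is locally compact and Hausdorff, $\boldsymbol r:\mathscr G\to\mathscr G^{(0)}$ is a local homeomorphism, and $\mathscr G^{(0)}$ has a basis of compact open sets. It is *minimal* if the only open subsets $U\subseteq \mathscr G^{(0)}$ that are invariant (that is, $\boldsymbol d(g)\in U\iff \boldsymbol r(g)\in U$ for all $g\in\mathscr G$) are $\emptyset$ and $\mathscr G^{(0)}$. It is *effective* if $\mathscr G^{(0)}$ equals the interior in $\mathscr G$ of $\mathrm{Iso}(\mathscr G)=\{g\in\mathscr G:\boldsymbol d(g)=\boldsymbol r(g)\}$. **Theorem.** Let $\mathscr G$ be a nonempty ample groupoid whose arrow space is Hausdorff, and let $C_c(\mathscr G)$ be the algebra of compactly supported continuous functions $\mathscr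 G\to\mathbb C$ with pointwise linear structure and convolution product $(f*g)(\gamma)=\sum_{\alpha\beta=\gamma}f(\alpha)g(\beta)$. Then $C_c(\mathscr G)$ is simple as a ring (it is nonzero and its only two-sided ideals are $\{0\}$ and $C_c(\mathscr G)$) if and only if $\mathscr G$ is minimal and effective. -/

import Mathlib

namespace AmpleGroupoid

open CategoryTheory Topology Set
open scoped CompactlySupported

universe v u

/-! ### The arrow space of a groupoid -/

section Algebra

variable {X : Type u} [Groupoid.{v} X]

variable (X) in
/-- The set of all arrows of the groupoid with object set `X`. -/
abbrev Arr : Type max u v := Quiver.Total X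

/-- The source of an arrow, regarded as an identity arrow. -/
def d (g : Arr X) : Arr X := ⟨g.left, g.left, 𝟙 g.left⟩

/-- The range of an arrow, regarded as an identity arrow. -/
def r (g : Arr X) : Arr X := ⟨g.right, g.right, 𝟙 g.right⟩

/-- The inverse of an arrow. -/
instance instInvArr : Inv (Arr X) := ⟨fun g => ⟨g.right, g.left, Groupoid.inv g.hom⟩⟩

open Classical in
/-- The product `a * b` of arrows, meaning "first `b`, then `a`". It is the groupoid product
when `d a = r b`; its value in the other case is irrelevant and never used. -/
noncomputable instance instMulArr : Mul (Arr X) :=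
  ⟨fun a b => if h : b.right = a.left then ⟨b.left, a.right, b.hom ≫ eqToHom h ≫ a.hom⟩ else a⟩

theorem d_eq_r_iff {a b : Arr X} : d a = r b ↔ b.right = a.left := by
  constructor
  · intro h
    exact (congrArg Quiver.Total.left h).symm
  · intro h
    obtain ⟨y, z, q⟩ := a
    obtain ⟨x, y', p⟩ := b
    obtain rfl : y' = y := h
    rfl

theorem mul_mk {x y z : X} (q : y ⟶ z) (p : x ⟶ y) :
    (⟨y, z, q⟩ * ⟨x, y, p⟩ : Arr X) = ⟨x, z, p ≫ q⟩ := by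
  refine (dif_pos rfl).trans ?_
  simp

theorem inv_mk {x y : X} (p : x ⟶ y) : (⟨x, y, p⟩⁻¹ : Arr X) = ⟨y, x, Groupoid.inv p⟩ := rfl

theorem r_eq (g : Arr X) : r g = g * g⁻¹ := by
  obtain ⟨x, y, p⟩ := g
  rw [inv_mk, mul_mk]
  simp [r]

theorem d_eq (g : Arr X) : d g = g⁻¹ * g := by
  obtain ⟨x, y, p⟩ := g
  rw [inv_mk, mul_mk]
  simp [d]

@[simp] theorem d_inv (g : Arr X) : d g⁻¹ = r g := rfl
@[simp] theorem r_inv (g : Arr X) : r g⁻¹ = d g := rfl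
@[simp] theorem r_r (g : Arr X) : r (r g) = r g := rfl
@[simp] theorem r_d (g : Arr X) : r (d g) = d g := rfl
@[simp] theorem d_r (g : Arr X) : d (r g) = r g := rfl
@[simp] theorem d_d (g : Arr X) : d (d g) = d g := rfl

/-- Composable arrows come from composable morphisms. -/
theorem exists_of_composable {a b : Arr X} (h : d a = r b) :
    ∃ (x y z : X) (p : x ⟶ y) (q : y ⟶ z), a = ⟨y, z, q⟩ ∧ b = ⟨x, y, p⟩ := by
  obtain ⟨y, z, q⟩ := a
  obtain ⟨x, y', p⟩ := b
  obtain rfl : y' = y := d_eq_r_iff.1 h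
  exact ⟨_, _, _, p, q, rfl, rfl⟩

theorem d_mul {a b : Arr X} (h : d a = r b) : d (a * b) = d b := by
  obtain ⟨x, y, z, p, q, rfl, rfl⟩ := exists_of_composable h
  rw [mul_mk]; rfl

theorem r_mul {a b : Arr X} (h : d a = r b) : r (a * b) = r a := by
  obtain ⟨x, y, z, p, q, rfl, rfl⟩ := exists_of_composable h
  rw [mul_mk]; rfl

theorem mul_assoc' {a b c : Arr X} (h : d a = r b) (h' : d b = r c) :
    a * b * c = a * (b * c) := by
  obtain ⟨x, y, z, p, q, rfl, rfl⟩ := exists_of_composable h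
  obtain ⟨w, y', p'⟩ := c
  obtain rfl : y' = x := d_eq_r_iff.1 h'
  simp only [mul_mk, Category.assoc]

theorem inv_mul_cancel_left' {a b : Arr X} (h : d a = r b) : a⁻¹ * (a * b) = b := by
  obtain ⟨x, y, z, p, q, rfl, rfl⟩ := exists_of_composable h
  simp [mul_mk, inv_mk]

theorem mul_inv_cancel_left' {a b : Arr X} (h : r a = r b) : a * (a⁻¹ * b) = b := by
  have := inv_mul_cancel_left' (a := a⁻¹) (b := b) h
  obtain ⟨x, y, p⟩ := a
  simpa [inv_mk] using this

theorem inv_inv' (a : Arr X) : a⁻¹⁻¹ = a := by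
  obtain ⟨x, y, p⟩ := a
  simp [inv_mk]

theorem mul_inv_rev' {a b : Arr X} (h : d a = r b) : (a * b)⁻¹ = b⁻¹ * a⁻¹ := by
  obtain ⟨x, y, z, p, q, rfl, rfl⟩ := exists_of_composable h
  simp [mul_mk, inv_mk]

variable (X) in
/-- The unit space: the set of identity arrows `g * g⁻¹`. -/
def unitSpace : Set (Arr X) := Set.range (r : Arr X → Arr X)

/-- The source map as a map onto the unit space. -/
def dMap (g : Arr X) : unitSpace X := ⟨d g, d g, rfl⟩

/-- The range map as a map onto the unit space. -/
def rMap (g : Arr X) : unitSpace X := ⟨r g, g, rfl⟩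

theorem rMap_eq_iff {a b : Arr X} : rMap a = rMap b ↔ r a = r b := Subtype.ext_iff

variable (X) in
/-- The isotropy subgroupoid. -/
def iso : Set (Arr X) := {g | d g = r g}

/-- A set of units is invariant if it contains the source of an arrow exactly when it contains
its range. -/
def IsInvariant (D : Set (unitSpace X)) : Prop := ∀ g : Arr X, dMap g ∈ D ↔ rMap g ∈ D

/-- Convolution: `(f * g)(γ) = ∑ f(α) g(β)` over all composable pairs with `α * β = γ`; such a pair
is `(α, α⁻¹ * γ)` with `r α = r γ`. -/
noncomputable def conv (f g : Arr X → ℂ) (γ : Arr X) : ℂ :=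
  ∑ᶠ α ∈ {α : Arr X | r α = r γ}, f α * g (α⁻¹ * γ)

/-- The convolution is the sum over all factorizations. -/
theorem conv_eq (f g : Arr X → ℂ) (γ : Arr X) :
    conv f g γ = ∑ᶠ p ∈ {p : Arr X × Arr X | d p.1 = r p.2 ∧ p.1 * p.2 = γ}, f p.1 * g p.2 := by
  symm
  refine finsum_mem_eq_of_bijOn Prod.fst ⟨?_, ?_, ?_⟩ ?_
  · rintro ⟨a, b⟩ ⟨h, rfl⟩
    exact (r_mul h).symm
  · rintro ⟨a, b⟩ ⟨h, h1⟩ ⟨a', b'⟩ ⟨h', h1'⟩ (rfl : a = a')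
    simp only at h h' h1 h1'
    rw [Prod.mk.injEq]
    exact ⟨rfl, by rw [← inv_mul_cancel_left' h, ← inv_mul_cancel_left' h', h1, h1']⟩
  · intro a ha
    have ha' : r a = r γ := ha
    refine ⟨(a, a⁻¹ * γ), ⟨?_, mul_inv_cancel_left' ha'⟩, rfl⟩
    change d a = r (a⁻¹ * γ)
    rw [r_mul (by simpa using ha'), r_inv]
  · rintro ⟨a, b⟩ ⟨h, rfl⟩
    change f a * g b = f a * g (a⁻¹ * (a * b))
    rw [inv_mul_cancel_left' h]

theorem conv_eq_sum {f g : Arr X → ℂ} {γ : Arr X} (S : Finset (Arr X))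
    (hS : ∀ a ∈ S, r a = r γ) (h : ∀ a, r a = r γ → f a * g (a⁻¹ * γ) ≠ 0 → a ∈ S) :
    conv f g γ = ∑ a ∈ S, f a * g (a⁻¹ * γ) := by
  refine finsum_mem_eq_sum_of_inter_support_eq _ ?_
  ext a
  exact ⟨fun ha => ⟨h a ha.1 ha.2, ha.2⟩, fun ha => ⟨hS a ha.1, ha.2⟩⟩

end Algebra

/-! ### Topological, étale and ample groupoids -/

section Topological

variable (X : Type u) [Groupoid.{v} X] [TopologicalSpace (Arr X)]

/-- A topological groupoid: the product of composable arrows and the inverse are continuous. -/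
class IsTopologicalGroupoid : Prop where
  continuousOn_mul :
    ContinuousOn (fun p : Arr X × Arr X => p.1 * p.2) {p : Arr X × Arr X | d p.1 = r p.2}
  continuous_inv : Continuous (fun g : Arr X => g⁻¹)

/-- An étale groupoid: the unit space is locally compact and Hausdorff, and the range map is a
local homeomorphism onto the unit space. -/
class IsEtaleGroupoid : Prop extends IsTopologicalGroupoid X where
  locallyCompact_unitSpace : LocallyCompactSpace (unitSpace X)
  t2_unitSpace : T2Space (unitSpace X)
  isLocalHomeomorph_rMap : IsLocalHomeomorph (rMap : Arr X → unitSpace X)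

/-- An ample groupoid: an étale groupoid whose unit space has a basis of compact open sets. -/
class IsAmpleGroupoid : Prop extends IsEtaleGroupoid X where
  isTopologicalBasis_compactOpen :
    TopologicalSpace.IsTopologicalBasis {U : Set (unitSpace X) | IsCompact U ∧ IsOpen U}

/-- A groupoid is minimal if the only open invariant subsets of its unit space are the empty set
and the whole unit space. -/
def IsMinimal : Prop :=
  ∀ U : Set (unitSpace X), IsOpen U → IsInvariant U → U = ∅ ∨ U = Set.univ

/-- A groupoid is effective if its unit space is the interior of its isotropy subgroupoid. -/
def IsEffective : Prop := unitSpace X = interior (iso X)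

/-- The space `C_c(𝒢)` of compactly supported continuous complex functions on the arrow space. It
carries the pointwise vector space structure, and the convolution product (defined below). -/
def ConvAlg : Type max u v := C_c(Arr X, ℂ)

end Topological

section Convolution

variable {X : Type u} [Groupoid.{v} X] [TopologicalSpace (Arr X)]

namespace ConvAlg

instance : FunLike (ConvAlg X) (Arr X) ℂ := inferInstanceAs (FunLike C_c(Arr X, ℂ) (Arr X) ℂ)
noncomputable instance : AddCommGroup (ConvAlg X) := inferInstanceAs (AddCommGroup C_c(Arr X, ℂ))
noncomputable instance : Module ℂ (ConvAlg X) := inferInstanceAs (Module ℂ C_c(Arr X, ℂ))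

@[ext] theorem ext {f g : ConvAlg X} (h : ∀ x, f x = g x) : f = g := DFunLike.ext _ _ h
@[simp] theorem add_apply (f g : ConvAlg X) (x : Arr X) : (f + g) x = f x + g x := rfl
@[simp] theorem zero_apply (x : Arr X) : (0 : ConvAlg X) x = 0 := rfl
@[simp] theorem smul_apply (c : ℂ) (f : ConvAlg X) (x : Arr X) : (c • f) x = c * f x := rfl

theorem continuous (f : ConvAlg X) : Continuous f :=
  f.toContinuousMap.continuous_toFun
theorem hasCompactSupport (f : ConvAlg X) : HasCompactSupport f :=
  CompactlySupportedContinuousMap.hasCompactSupport' f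

end ConvAlg

theorem continuous_r [IsTopologicalGroupoid X] : Continuous (r : Arr X → Arr X) := by
  have h : (r : Arr X → Arr X) = (fun p : Arr X × Arr X => p.1 * p.2) ∘ fun g => (g, g⁻¹) := by
    ext1 g; exact r_eq g
  rw [h]
  exact IsTopologicalGroupoid.continuousOn_mul.comp_continuous
    (continuous_id.prodMk IsTopologicalGroupoid.continuous_inv) (fun g => rfl)

theorem continuous_d [IsTopologicalGroupoid X] : Continuous (d : Arr X → Arr X) :=
  continuous_r.comp (IsTopologicalGroupoid.continuous_inv (X := X))

/-- A compact set meets every fibre of the range map in a finite set. -/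
theorem finite_fibre [IsEtaleGroupoid X] [T2Space (Arr X)] {K : Set (Arr X)} (hK : IsCompact K)
    (u : Arr X) : {a | a ∈ K ∧ r a = r u}.Finite := by
  have hc : IsCompact {a | a ∈ K ∧ r a = r u} :=
    hK.inter_right (isClosed_eq continuous_r continuous_const)
  choose e he heq using IsEtaleGroupoid.isLocalHomeomorph_rMap (X := X)
  obtain ⟨t, ht', ht⟩ := hc.elim_nhds_subcover (fun a => (e a).source)
    (fun a _ => (e a).open_source.mem_nhds (he a))
  refine t.finite_toSet.subset fun a ha => ?_
  obtain ⟨b, hb, hab⟩ := Set.mem_iUnion₂.1 (ht ha)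
  have : a = b := (e b).injOn hab (he b) (by
    rw [← heq b]
    exact rMap_eq_iff.2 (ha.2.trans (ht' b hb).2.symm))
  exact this ▸ hb

theorem finite_support_fibre [IsEtaleGroupoid X] [T2Space (Arr X)] (f : ConvAlg X) (u : Arr X) :
    {a | f a ≠ 0 ∧ r a = r u}.Finite :=
  (finite_fibre f.hasCompactSupport u).subset fun _ ha => ⟨subset_tsupport _ ha.1, ha.2⟩

/-- The product set of two compact sets of arrows is compact. -/
theorem isCompact_mul [IsTopologicalGroupoid X] [T2Space (Arr X)] {K L : Set (Arr X)}
    (hK : IsCompact K) (hL : IsCompact L) :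
    IsCompact ((fun p : Arr X × Arr X => p.1 * p.2) ''
      ((K ×ˢ L) ∩ {p : Arr X × Arr X | d p.1 = r p.2})) := by
  refine IsCompact.image_of_continuousOn ?_
    (IsTopologicalGroupoid.continuousOn_mul.mono Set.inter_subset_right)
  exact (hK.prod hL).inter_right
    (isClosed_eq (continuous_d.comp continuous_fst) (continuous_r.comp continuous_snd))

theorem hasCompactSupport_conv [IsEtaleGroupoid X] [T2Space (Arr X)] (f g : ConvAlg X) :
    HasCompactSupport (conv f g) := by
  refine HasCompactSupport.of_support_subset_isCompact
    (isCompact_mul f.hasCompactSupport g.hasCompactSupport) fun γ hγ => ?_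
  obtain ⟨a, ha, hne⟩ := exists_ne_zero_of_finsum_mem_ne_zero hγ
  have ha' : r a = r γ := ha
  refine ⟨(a, a⁻¹ * γ), ⟨⟨subset_tsupport _ (left_ne_zero_of_mul hne),
    subset_tsupport _ (right_ne_zero_of_mul hne)⟩, ?_⟩, mul_inv_cancel_left' ha'⟩
  change d a = r (a⁻¹ * γ)
  rw [r_mul (by simpa using ha'), r_inv]

theorem continuous_conv [IsEtaleGroupoid X] [T2Space (Arr X)] (f g : ConvAlg X) :
    Continuous (conv f g) := by
  classical
  rw [continuous_iff_continuousAt]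
  intro γ₀
  have hlh := IsEtaleGroupoid.isLocalHomeomorph_rMap (X := X)
  have hr : Continuous (rMap : Arr X → unitSpace X) := hlh.continuous
  have := IsEtaleGroupoid.t2_unitSpace (X := X)
  choose e he heq using hlh
  have hF := finite_fibre f.hasCompactSupport γ₀
  obtain ⟨U, hU, hdisj⟩ := hF.t2_separation
  set F := hF.toFinset with hFdef
  have memF : ∀ a, a ∈ F ↔ a ∈ tsupport f ∧ r a = r γ₀ := fun a => by simp [hFdef]
  set W : Arr X → Set (Arr X) := fun a => U a ∩ (e a).source with hW
  have hWo : ∀ a, IsOpen (W a) := fun a => (hU a).2.inter (e a).open_source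
  have hC : IsCompact (tsupport f \ ⋃ a ∈ F, W a) :=
    IsCompact.diff f.hasCompactSupport (isOpen_biUnion fun a _ => hWo a)
  -- the neighbourhood of `γ₀` on which local sections compute the convolution
  have hN1 : ∀ᶠ γ in 𝓝 γ₀, rMap γ ∉ rMap '' (tsupport f \ ⋃ a ∈ F, W a) := by
    refine hr.continuousAt.eventually ((hC.image hr).isClosed.isOpen_compl.mem_nhds ?_)
    rintro ⟨a, ⟨ha, ha'⟩, h⟩
    have haF : a ∈ F := (memF a).2 ⟨ha, rMap_eq_iff.1 h⟩
    exact ha' (Set.mem_iUnion₂.2 ⟨a, haF, (hU a).1, he a⟩)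
  have hpt : ∀ a ∈ F, e a a = rMap γ₀ := fun a ha => by
    rw [← heq a]; exact rMap_eq_iff.2 ((memF a).1 ha).2
  have hN2 : ∀ᶠ γ in 𝓝 γ₀, ∀ a ∈ F, rMap γ ∈ e a '' W a := by
    rw [Filter.eventually_all_finset]
    intro a ha
    refine hr.continuousAt.eventually (IsOpen.mem_nhds ?_ ⟨a, ⟨(hU a).1, he a⟩, hpt a ha⟩)
    exact (e a).isOpen_image_of_subset_source (hWo a) Set.inter_subset_right
  set σ : Arr X → Arr X → Arr X := fun a γ => (e a).symm (rMap γ) with hσ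
  have hσr : ∀ {a γ}, rMap γ ∈ e a '' W a → r (σ a γ) = r γ ∧ σ a γ ∈ W a := by
    rintro a γ ⟨b, hb, hbe⟩
    have : σ a γ = b := by rw [hσ]; simp only; rw [← hbe, (e a).left_inv hb.2]
    rw [this]
    refine ⟨rMap_eq_iff.1 ?_, hb⟩
    rw [← hbe]
    exact congrFun (heq a) b
  have hev : ∀ᶠ γ in 𝓝 γ₀,
      conv f g γ = ∑ a ∈ F, f (σ a γ) * g ((σ a γ)⁻¹ * γ) := by
    filter_upwards [hN1, hN2] with γ h1 h2
    have hinj : Set.InjOn (fun a => σ a γ) F := by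
      intro a ha b hb hab
      by_contra hne
      have hd : Disjoint (U a) (U b) := hdisj (by simpa using (memF a).1 ha)
        (by simpa using (memF b).1 hb) hne
      refine Set.disjoint_left.1 hd (hσr (h2 a ha)).2.1 ?_
      have : σ a γ = σ b γ := hab
      rw [this]
      exact (hσr (h2 b hb)).2.1
    rw [conv_eq_sum (F.image fun a => σ a γ), Finset.sum_image hinj]
    · intro b hb
      obtain ⟨a, ha, rfl⟩ := Finset.mem_image.1 hb
      exact (hσr (h2 a ha)).1
    · intro b hb hne
      have hbs : b ∈ tsupport f := subset_tsupport _ (left_ne_zero_of_mul hne)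
      have hbW : b ∈ ⋃ a ∈ F, W a := by
        by_contra hcon
        exact h1 ⟨b, ⟨hbs, hcon⟩, rMap_eq_iff.2 hb⟩
      obtain ⟨a, ha, hba⟩ := Set.mem_iUnion₂.1 hbW
      refine Finset.mem_image.2 ⟨a, ha, ?_⟩
      refine (e a).injOn (hσr (h2 a ha)).2.2 hba.2 ?_
      rw [← heq a]
      exact rMap_eq_iff.2 ((hσr (h2 a ha)).1.trans hb.symm)
  refine ContinuousAt.congr ?_ (Filter.EventuallyEq.symm hev)
  refine tendsto_finsetSum _ fun a ha => ?_
  have hσc : ContinuousAt (σ a) γ₀ := by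
    refine ContinuousAt.comp (g := (e a).symm) ((e a).continuousAt_symm ?_) hr.continuousAt
    rw [← hpt a ha]
    exact (e a).map_source (he a)
  refine ContinuousAt.mul (f.continuous.continuousAt.comp hσc) ?_
  refine ContinuousAt.comp (g := g) (f := fun γ => (σ a γ)⁻¹ * γ) g.continuous.continuousAt ?_
  have hpair : ContinuousAt (fun γ => ((σ a γ)⁻¹, γ)) γ₀ :=
    ((IsTopologicalGroupoid.continuous_inv.continuousAt).comp hσc).prodMk continuousAt_id
  have hcomp : ∀ᶠ γ in 𝓝 γ₀, ((σ a γ)⁻¹, γ) ∈ {p : Arr X × Arr X | d p.1 = r p.2} := by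
    filter_upwards [hN2] with γ h2
    exact (hσr (h2 a ha)).1
  have hmem := hcomp.self_of_nhds
  exact (IsTopologicalGroupoid.continuousOn_mul _ hmem).tendsto.comp
    (tendsto_nhdsWithin_iff.2 ⟨hpair, hcomp⟩)

namespace ConvAlg

variable [IsEtaleGroupoid X] [T2Space (Arr X)]

/-- The convolution product on `C_c(𝒢)`. -/
noncomputable instance : Mul (ConvAlg X) :=
  ⟨fun f g => ⟨⟨conv f g, continuous_conv f g⟩, hasCompactSupport_conv f g⟩⟩

theorem mul_apply (f g : ConvAlg X) (γ : Arr X) : (f * g) γ = conv f g γ := rfl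

theorem mul_apply_eq_sum (f g : ConvAlg X) (γ : Arr X) (S : Finset (Arr X))
    (hS : ∀ a ∈ S, r a = r γ) (h : ∀ a, r a = r γ → f a ≠ 0 → a ∈ S) :
    (f * g) γ = ∑ a ∈ S, f a * g (a⁻¹ * γ) :=
  conv_eq_sum S hS fun a ha hne => h a ha (left_ne_zero_of_mul hne)

theorem mul_apply_eq_sum' (f g : ConvAlg X) (γ : Arr X) (S : Finset (Arr X))
    (hS : ∀ a ∈ S, r a = r γ) (h : ∀ a, r a = r γ → g (a⁻¹ * γ) ≠ 0 → a ∈ S) :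
    (f * g) γ = ∑ a ∈ S, f a * g (a⁻¹ * γ) :=
  conv_eq_sum S hS fun a ha hne => h a ha (right_ne_zero_of_mul hne)

theorem finite_left (f : ConvAlg X) (γ : Arr X) :
    ∃ S : Finset (Arr X), (∀ a ∈ S, r a = r γ) ∧ ∀ a, r a = r γ → f a ≠ 0 → a ∈ S :=
  ⟨(finite_support_fibre f γ).toFinset, by simp, by simp; tauto⟩

theorem finite_right (g : ConvAlg X) (γ : Arr X) :
    ∃ S : Finset (Arr X), (∀ a ∈ S, r a = r γ) ∧ ∀ a, r a = r γ → g (a⁻¹ * γ) ≠ 0 → a ∈ S := by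
  classical
  have hK := hasCompactSupport g |>.isCompact.image (IsTopologicalGroupoid.continuous_inv (X := X))
  have hfin := (finite_fibre hK γ⁻¹).image fun b => γ * b
  have h : {a | r a = r γ ∧ g (a⁻¹ * γ) ≠ 0}.Finite := by
    refine hfin.subset fun a ha => ?_
    have hc : d a⁻¹ = r γ := ha.1
    refine ⟨(a⁻¹ * γ)⁻¹, ⟨⟨_, subset_tsupport _ ha.2, rfl⟩, ?_⟩, ?_⟩
    · rw [r_inv, d_mul hc, r_inv]
    · simp only
      rw [mul_inv_rev' hc, inv_inv', mul_inv_cancel_left' ha.1.symm]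
  exact ⟨h.toFinset, fun a ha => (h.mem_toFinset.1 ha).1, fun a h1 h2 => h.mem_toFinset.2 ⟨h1, h2⟩⟩

protected theorem add_mul (f g h : ConvAlg X) : (f + g) * h = f * h + g * h := by
  ext γ
  obtain ⟨S, hS, hh⟩ := finite_right h γ
  rw [add_apply, mul_apply_eq_sum' _ _ _ S hS hh, mul_apply_eq_sum' _ _ _ S hS hh,
    mul_apply_eq_sum' _ _ _ S hS hh, ← Finset.sum_add_distrib]
  simp only [add_apply, add_mul]

protected theorem mul_add (f g h : ConvAlg X) : f * (g + h) = f * g + f * h := by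
  ext γ
  obtain ⟨S, hS, hh⟩ := finite_left f γ
  rw [add_apply, mul_apply_eq_sum _ _ _ S hS hh, mul_apply_eq_sum _ _ _ S hS hh,
    mul_apply_eq_sum _ _ _ S hS hh, ← Finset.sum_add_distrib]
  simp only [add_apply, mul_add]

protected theorem smul_mul (c : ℂ) (f g : ConvAlg X) : (c • f) * g = c • (f * g) := by
  ext γ
  obtain ⟨S, hS, hh⟩ := finite_right g γ
  rw [smul_apply, mul_apply_eq_sum' _ _ _ S hS hh, mul_apply_eq_sum' _ _ _ S hS hh,
    Finset.mul_sum]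
  simp only [smul_apply, mul_assoc]

protected theorem mul_smul (c : ℂ) (f g : ConvAlg X) : f * (c • g) = c • (f * g) := by
  ext γ
  obtain ⟨S, hS, hh⟩ := finite_left f γ
  rw [smul_apply, mul_apply_eq_sum _ _ _ S hS hh, mul_apply_eq_sum _ _ _ S hS hh,
    Finset.mul_sum]
  simp only [smul_apply, mul_left_comm]

protected theorem mul_assoc (f g h : ConvAlg X) : f * g * h = f * (g * h) := by
  classical
  ext γ
  obtain ⟨S, hS, hf⟩ := finite_left f γ
  obtain ⟨T, hT, hh⟩ := finite_right h γ
  rw [mul_apply_eq_sum' _ _ _ T hT hh, mul_apply_eq_sum _ _ _ S hS hf]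
  have h1 : ∀ a ∈ T, (f * g) a * h (a⁻¹ * γ) = ∑ b ∈ S, f b * (g (b⁻¹ * a) * h (a⁻¹ * γ)) := by
    intro a ha
    rw [mul_apply_eq_sum f g a S (fun b hb => (hS b hb).trans (hT a ha).symm)
      (fun b hb hne => hf b (hb.trans (hT a ha)) hne), Finset.sum_mul]
    simp only [mul_assoc]
  rw [Finset.sum_congr rfl h1, Finset.sum_comm]
  refine Finset.sum_congr rfl fun b hb => ?_
  rw [← Finset.mul_sum]
  congr 1
  have hbγ : d b⁻¹ = r γ := hS b hb
  have hba : ∀ a ∈ T, d b⁻¹ = r a := fun a ha => (hS b hb).trans (hT a ha).symm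
  have hinj : Set.InjOn (fun a => b⁻¹ * a) T := by
    intro a ha a' ha' haa
    have haa' : b⁻¹ * a = b⁻¹ * a' := haa
    rw [← mul_inv_cancel_left' (a := b) (b := a) (hba a ha), haa', mul_inv_cancel_left' (hba a' ha')]
  rw [mul_apply_eq_sum' g h (b⁻¹ * γ) (T.image fun a => b⁻¹ * a), Finset.sum_image hinj]
  · refine Finset.sum_congr rfl fun a ha => ?_
    have hac : d a⁻¹ = r b := (hT a ha).trans (hS b hb).symm
    rw [mul_inv_rev' (hba a ha), inv_inv', mul_assoc' hac
      (show d b = r (b⁻¹ * γ) by rw [r_mul hbγ, r_inv]), mul_inv_cancel_left' (hS b hb)]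
  · intro c hc
    obtain ⟨a, ha, rfl⟩ := Finset.mem_image.1 hc
    rw [r_mul (hba a ha), r_mul hbγ]
  · intro c hc hne
    have hbc : d b = r c := by rw [hc, r_mul hbγ, r_inv]
    refine Finset.mem_image.2 ⟨b * c, hh _ ?_ ?_, inv_mul_cancel_left' hbc⟩
    · rw [r_mul hbc]; exact hS b hb
    · rw [mul_inv_rev' hbc, mul_assoc' (by rw [d_inv, r_inv, hbc]) hbγ]
      exact hne

noncomputable instance : NonUnitalRing (ConvAlg X) :=
  { (inferInstance : AddCommGroup (ConvAlg X)), (inferInstance : Mul (ConvAlg X)) with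
    left_distrib := ConvAlg.mul_add
    right_distrib := ConvAlg.add_mul
    zero_mul := fun f => by
      have h := ConvAlg.add_mul 0 0 f
      rw [add_zero] at h
      exact left_eq_add.1 h
    mul_zero := fun f => by
      have h := ConvAlg.mul_add f 0 0
      rw [add_zero] at h
      exact left_eq_add.1 h
    mul_assoc := ConvAlg.mul_assoc }

instance : IsScalarTower ℂ (ConvAlg X) (ConvAlg X) := ⟨ConvAlg.smul_mul⟩
instance : SMulCommClass ℂ (ConvAlg X) (ConvAlg X) := ⟨fun c f g => (ConvAlg.mul_smul c f g).symm⟩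

end ConvAlg

end Convolution

end AmpleGroupoid

namespace AmpleGroupoid

open CategoryTheory Topology Set

universe v u

/-! ### Algebra of units. -/

section Units

variable {X : Type u} [Groupoid.{v} X]

/-! Write `1_B` for the characteristic function of a compact open set `B`; since the arrow space is
Hausdorff, `B` is clopen and `1_B` lies in the algebra.

Minimal and effective implies simple. Let `f ≠ 0` lie in an ideal `I`. Multiplying by `1_C`, for a
bisection `C`, makes `f` nonzero at a unit. The part of the support away from the units is compact,
and effectiveness gives a nonempty open set of units, near which `f` does not vanish, such that no
arrow of that part has both ends in it (`exists_subset_disjoint_isCompact`). Take a compact open `V`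
inside it. Then `1_V * f * 1_V` is a nowhere vanishing function on `V`, and dividing by it gives
`1_V ∈ I` (`exists_charFn_mem`). The units having such a neighbourhood `V` with `1_V ∈ I` form an
open set, invariant under conjugation by bisections, so by minimality they are all units. Finite
unions of such sets provide left identities in `I` for every element of the algebra, whence `I = ⊤`.

Simple implies minimal and effective. A nontrivial invariant open set `U` yields the proper nonzero
ideal of functions supported over `U`. If effectiveness fails, there is a nonempty compact open
bisection `B` of non-unit isotropy arrows. The algebra acts on functions on the unit space, and
there `1_B` and `1_{r(B)}` act alike; so `1_B - 1_{r(B)}` is a nonzero element of the kernel, while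
`1_{r(B)}` is not in the kernel. -/

theorem r_mem_unitSpace (g : Arr X) : r g ∈ unitSpace X := ⟨g, rfl⟩

theorem mem_unitSpace_iff {g : Arr X} : g ∈ unitSpace X ↔ r g = g :=
  ⟨by rintro ⟨a, rfl⟩; rfl, fun h => ⟨g, h⟩⟩

theorem d_eq_self {g : Arr X} (h : g ∈ unitSpace X) : d g = g := by
  obtain ⟨a, rfl⟩ := h; rfl

theorem r_eq_self {g : Arr X} (h : g ∈ unitSpace X) : r g = g := mem_unitSpace_iff.1 h

theorem mul_d (g : Arr X) : g * d g = g := by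
  obtain ⟨x, y, p⟩ := g
  simp [d, mul_mk]

theorem r_mul_self (g : Arr X) : r g * g = g := by
  obtain ⟨x, y, p⟩ := g
  simp [r, mul_mk]

theorem inv_r (g : Arr X) : (r g)⁻¹ = r g := by
  obtain ⟨x, y, p⟩ := g
  simp [r, inv_mk]

theorem r_inv_mul {a b : Arr X} (h : r a = r b) : r (a⁻¹ * b) = d a := by
  rw [r_mul (by simpa using h), r_inv]

/-- If `a⁻¹ * b` is a unit then `a = b`. -/
theorem eq_of_inv_mul_mem_unitSpace {a b : Arr X} (h : r a = r b)
    (hu : a⁻¹ * b ∈ unitSpace X) : a = b := by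
  have h1 : a⁻¹ * b = d a := by rw [← r_inv_mul h, r_eq_self hu]
  rw [← mul_inv_cancel_left' h, h1, mul_d]

theorem image_r_subset_unitSpace (B : Set (Arr X)) : r '' B ⊆ unitSpace X :=
  image_subset_range _ _

end Units

/-! ### Topology of the unit space and compact open bisections. -/

section Topology

variable {X : Type u} [Groupoid.{v} X] [TopologicalSpace (Arr X)]

/-- The arrows `g` and `r g` have the same range; when both are near a unit, local injectivity of
the range map forces `r g = g`. -/
theorem isOpen_unitSpace [IsEtaleGroupoid X] : IsOpen (unitSpace X) := by
  rw [isOpen_iff_mem_nhds]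
  intro u hu
  obtain ⟨e, he, heq⟩ := IsEtaleGroupoid.isLocalHomeomorph_rMap (X := X) u
  have hW : IsOpen (e.source ∩ r ⁻¹' e.source) :=
    e.open_source.inter (e.open_source.preimage continuous_r)
  refine Filter.mem_of_superset (hW.mem_nhds ⟨he, ?_⟩) ?_
  · rw [mem_preimage, r_eq_self hu]
    exact he
  · rintro g ⟨hg, hg'⟩
    refine mem_unitSpace_iff.2 (e.injOn hg' hg ?_)
    rw [← heq]
    exact rMap_eq_iff.2 rfl

theorem isClosed_unitSpace [IsTopologicalGroupoid X] [T2Space (Arr X)] :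
    IsClosed (unitSpace X) := by
  have h : unitSpace X = {g | r g = g} := ext fun _ => mem_unitSpace_iff
  rw [h]
  exact isClosed_eq continuous_r continuous_id

theorem isOpenMap_r [IsEtaleGroupoid X] : IsOpenMap (r : Arr X → Arr X) :=
  isOpen_unitSpace.isOpenMap_subtype_val.comp
    (IsEtaleGroupoid.isLocalHomeomorph_rMap (X := X)).isOpenMap

theorem isCompact_isOpen_image_r [IsEtaleGroupoid X] {B : Set (Arr X)} (hB : IsCompact B ∧ IsOpen B) :
    IsCompact (r '' B) ∧ IsOpen (r '' B) :=
  ⟨hB.1.image continuous_r, isOpenMap_r _ hB.2⟩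

/-- A compact open bisection: a compact open set of arrows on which range and source are
injective. -/
structure IsCompactOpenBisection (B : Set (Arr X)) : Prop where
  isCompact : IsCompact B
  isOpen : IsOpen B
  injOn_r : InjOn r B
  injOn_d : InjOn d B

theorem IsCompactOpenBisection.inv [IsTopologicalGroupoid X] {B : Set (Arr X)}
    (hB : IsCompactOpenBisection B) : IsCompactOpenBisection ((fun g : Arr X => g⁻¹) ⁻¹' B) := by
  have hinv : Function.Involutive (fun g : Arr X => g⁻¹) := inv_inv'
  have hc := IsTopologicalGroupoid.continuous_inv (X := X)
  refine ⟨?_, hB.isOpen.preimage hc, ?_, ?_⟩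
  · rw [← hinv.image_eq_preimage_symm]
    exact hB.isCompact.image hc
  · intro a ha b hb hab
    exact hinv.injective (hB.injOn_d ha hb hab)
  · intro a ha b hb hab
    exact hinv.injective (hB.injOn_r ha hb hab)

/-- In an ample groupoid the compact open bisections form a basis of the topology. -/
theorem exists_isCompactOpenBisection [IsAmpleGroupoid X] {O : Set (Arr X)} (hO : IsOpen O)
    {g : Arr X} (hg : g ∈ O) : ∃ B, IsCompactOpenBisection B ∧ g ∈ B ∧ B ⊆ O := by
  have hlh := IsEtaleGroupoid.isLocalHomeomorph_rMap (X := X)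
  obtain ⟨e, he, heq⟩ := hlh g
  obtain ⟨e', he', heq'⟩ := hlh g⁻¹
  have hinv := IsTopologicalGroupoid.continuous_inv (X := X)
  -- On `W` the chart `e` makes `r` injective, and the chart `e'` applied to inverses makes `d`
  -- injective. A compact open set of units inside `e '' W` then lifts along the local section
  -- `e.symm`.
  set W := e.source ∩ (O ∩ (fun g : Arr X => g⁻¹) ⁻¹' e'.source) with hWdef
  have hW : IsOpen W := e.open_source.inter (hO.inter (e'.open_source.preimage hinv))
  have hWs : W ⊆ e.source := inter_subset_left
  have hWd : InjOn d W := by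
    intro a ha b hb hab
    have h : a⁻¹ = b⁻¹ := e'.injOn ha.2.2 hb.2.2 (by
      rw [← heq']
      exact rMap_eq_iff.2 hab)
    rw [← inv_inv' a, h, inv_inv']
  have hWr : InjOn r W := by
    intro a ha b hb hab
    refine e.injOn (hWs ha) (hWs hb) ?_
    rw [← heq]
    exact rMap_eq_iff.2 hab
  obtain ⟨V, ⟨hVc, hVo⟩, hgV, hVW⟩ :=
    (IsAmpleGroupoid.isTopologicalBasis_compactOpen (X := X)).exists_subset_of_mem_open
      (mem_image_of_mem e (show g ∈ W from ⟨he, hg, he'⟩)) (e.isOpen_image_of_subset_source hW hWs)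
  have hVt : V ⊆ e.target := by
    refine hVW.trans ?_
    rintro _ ⟨a, ha, rfl⟩
    exact e.map_source (hWs ha)
  have hBW : e.symm '' V ⊆ W := by
    rintro _ ⟨v, hv, rfl⟩
    obtain ⟨a, ha, rfl⟩ := hVW hv
    rwa [e.left_inv (hWs ha)]
  refine ⟨e.symm '' V, ⟨hVc.image_of_continuousOn (e.symm.continuousOn.mono hVt),
    e.symm.isOpen_image_of_subset_source hVo hVt, hWr.mono hBW, hWd.mono hBW⟩,
    ⟨e g, hgV, e.left_inv he⟩, fun a ha => (hBW ha).2.1⟩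

end Topology

/-! ### Extension by zero and characteristic functions. -/

section Restrict

variable {X : Type u} [Groupoid.{v} X] [TopologicalSpace (Arr X)] [T2Space (Arr X)]

/-- The extension by zero of a function that is continuous on a compact open set of arrows. -/
noncomputable def extendZero (B : Set (Arr X)) (hB : IsCompact B ∧ IsOpen B) (φ : Arr X → ℂ)
    (hφ : ContinuousOn φ B) : ConvAlg X :=
  ⟨⟨B.indicator φ, by
    refine continuous_iff_continuousAt.2 fun g => ?_
    by_cases hg : g ∈ B
    · refine (hφ.continuousAt (hB.2.mem_nhds hg)).congr ?_
      filter_upwards [hB.2.mem_nhds hg] with a ha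
      exact (indicator_of_mem ha φ).symm
    · refine (continuousAt_const (y := (0 : ℂ))).congr ?_
      filter_upwards [hB.1.isClosed.isOpen_compl.mem_nhds hg] with a ha
      exact (indicator_of_notMem ha φ).symm⟩,
    HasCompactSupport.of_support_subset_isCompact hB.1 support_indicator_subset⟩

theorem extendZero_apply {B : Set (Arr X)} {hB : IsCompact B ∧ IsOpen B} {φ : Arr X → ℂ}
    {hφ : ContinuousOn φ B} (g : Arr X) : extendZero B hB φ hφ g = B.indicator φ g := rfl

/-- The characteristic function of a compact open set of arrows. -/
noncomputable def charFn (B : Set (Arr X)) (hB : IsCompact B ∧ IsOpen B) : ConvAlg X :=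
  extendZero B hB (fun _ => 1) continuousOn_const

theorem charFn_of_mem {B : Set (Arr X)} (hB : IsCompact B ∧ IsOpen B) {g : Arr X} (hg : g ∈ B) :
    charFn B hB g = 1 :=
  indicator_of_mem (f := fun _ => (1 : ℂ)) hg

theorem charFn_of_notMem {B : Set (Arr X)} (hB : IsCompact B ∧ IsOpen B) {g : Arr X}
    (hg : g ∉ B) : charFn B hB g = 0 :=
  indicator_of_notMem (f := fun _ => (1 : ℂ)) hg

theorem mem_of_charFn_ne_zero {B : Set (Arr X)} {hB : IsCompact B ∧ IsOpen B} {g : Arr X}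
    (hg : charFn B hB g ≠ 0) : g ∈ B := by
  by_contra h
  exact hg (charFn_of_notMem hB h)

theorem charFn_ne_zero {B : Set (Arr X)} (hB : IsCompact B ∧ IsOpen B) {g : Arr X} (hg : g ∈ B) :
    charFn B hB ≠ 0 := by
  intro h
  have h1 := charFn_of_mem hB hg
  rw [h] at h1
  exact zero_ne_one h1

end Restrict

/-! ### Convolution with characteristic functions. -/

section Product

variable {X : Type u} [Groupoid.{v} X]

/-- A convolution with at most one nonzero term. -/
theorem conv_eq_single {f g : Arr X → ℂ} {γ a : Arr X} (ha : r a = r γ)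
    (h : ∀ b, r b = r γ → f b ≠ 0 → g (b⁻¹ * γ) ≠ 0 → b = a) :
    conv f g γ = f a * g (a⁻¹ * γ) := by
  rw [conv_eq_sum {a} (by simpa using ha) fun b hb hne => Finset.mem_singleton.2
    (h b hb (left_ne_zero_of_mul hne) (right_ne_zero_of_mul hne)), Finset.sum_singleton]

theorem conv_eq_zero {f g : Arr X → ℂ} {γ : Arr X}
    (h : ∀ b, r b = r γ → f b * g (b⁻¹ * γ) = 0) : conv f g γ = 0 := by
  rw [conv_eq_sum ∅ (by simp) fun b hb hne => absurd (h b hb) hne, Finset.sum_empty]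

variable [TopologicalSpace (Arr X)]

theorem neg_apply (f : ConvAlg X) (x : Arr X) : (-f) x = -f x := rfl

theorem conv_eq_sum_left (f : ConvAlg X) (h : Arr X → ℂ) {γ : Arr X} (S : Finset (Arr X))
    (hS : ∀ a ∈ S, r a = r γ) (hf : ∀ a, r a = r γ → f a ≠ 0 → a ∈ S) :
    conv f h γ = ∑ a ∈ S, f a * h (a⁻¹ * γ) :=
  conv_eq_sum S hS fun a ha hne => hf a ha (left_ne_zero_of_mul hne)

variable [T2Space (Arr X)]

/-- The characteristic function of a bisection acts on functions on the unit space by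
translation. -/
theorem conv_charFn {B : Set (Arr X)} (hB : IsCompact B ∧ IsOpen B) (hBr : InjOn r B)
    {h : Arr X → ℂ} (hh : ∀ γ, h (r γ) = h γ) {b γ : Arr X} (hb : b ∈ B) (hbγ : r b = r γ) :
    conv (charFn B hB) h γ = h (d b) := by
  rw [conv_eq_single hbγ fun c hc hne _ => hBr (mem_of_charFn_ne_zero hne) hb (hc.trans hbγ.symm),
    charFn_of_mem _ hb, one_mul, ← hh, r_inv_mul hbγ]

variable [IsEtaleGroupoid X]

/-- The only factorization of `γ` with a unit on the left is `r γ * γ`, so functions supported on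
units act by pointwise multiplication along the range. -/
theorem extendZero_mul_apply {B : Set (Arr X)} (hB : IsCompact B ∧ IsOpen B) {φ : Arr X → ℂ}
    (hφ : ContinuousOn φ B) (hu : B ⊆ unitSpace X) (g : ConvAlg X) (γ : Arr X) :
    (extendZero B hB φ hφ * g) γ = B.indicator φ (r γ) * g γ := by
  rw [ConvAlg.mul_apply, conv_eq_single (a := r γ) (r_r γ), inv_r, r_mul_self, extendZero_apply]
  intro b hb hne _
  rw [← hb, r_eq_self (hu (mem_of_indicator_ne_zero hne))]

theorem mul_extendZero_apply {B : Set (Arr X)} (hB : IsCompact B ∧ IsOpen B) {φ : Arr X → ℂ}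
    (hφ : ContinuousOn φ B) (hu : B ⊆ unitSpace X) (g : ConvAlg X) (γ : Arr X) :
    (g * extendZero B hB φ hφ) γ = g γ * B.indicator φ (d γ) := by
  rw [ConvAlg.mul_apply, conv_eq_single (a := γ) rfl, ← d_eq, extendZero_apply]
  intro b hb _ hne
  exact eq_of_inv_mul_mem_unitSpace hb (hu (mem_of_indicator_ne_zero hne))

theorem charFn_mul_eq_self {B : Set (Arr X)} (hB : IsCompact B ∧ IsOpen B)
    (hu : B ⊆ unitSpace X) (g : ConvAlg X) (h : ∀ γ, g γ ≠ 0 → r γ ∈ B) :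
    charFn B hB * g = g := by
  ext γ
  rw [charFn, extendZero_mul_apply hB _ hu]
  by_cases hγ : g γ = 0
  · rw [hγ, mul_zero]
  · rw [indicator_of_mem (h γ hγ), one_mul]

theorem mul_charFn_eq_self {B : Set (Arr X)} (hB : IsCompact B ∧ IsOpen B)
    (hu : B ⊆ unitSpace X) (g : ConvAlg X) (h : ∀ γ, g γ ≠ 0 → d γ ∈ B) :
    g * charFn B hB = g := by
  ext γ
  rw [charFn, mul_extendZero_apply hB _ hu]
  by_cases hγ : g γ = 0
  · rw [hγ, zero_mul]
  · rw [indicator_of_mem (h γ hγ), mul_one]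

/-- Inclusion–exclusion: on units, convolution is pointwise multiplication. It shows that an ideal
containing both characteristic functions contains that of the union. -/
theorem charFn_union {U V : Set (Arr X)} (hU : IsCompact U ∧ IsOpen U)
    (hV : IsCompact V ∧ IsOpen V) (hUu : U ⊆ unitSpace X) (hVu : V ⊆ unitSpace X) :
    charFn (U ∪ V) ⟨hU.1.union hV.1, hU.2.union hV.2⟩ =
      charFn U hU + (charFn V hV + (-1 : ℂ) • (charFn U hU * charFn V hV)) := by
  ext γ
  have hmul : (charFn U hU * charFn V hV) γ = charFn U hU (r γ) * charFn V hV γ :=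
    extendZero_mul_apply hU _ hUu _ γ
  rw [ConvAlg.add_apply, ConvAlg.add_apply, ConvAlg.smul_apply, hmul]
  by_cases h1 : γ ∈ U
  · rw [charFn_of_mem _ (Or.inl h1), r_eq_self (hUu h1), charFn_of_mem _ h1]
    ring
  · by_cases h2 : γ ∈ V
    · rw [charFn_of_mem _ (Or.inr h2), r_eq_self (hVu h2), charFn_of_mem _ h2,
        charFn_of_notMem _ h1]
      ring
    · rw [charFn_of_notMem _ (not_or_intro h1 h2), charFn_of_notMem _ h1, charFn_of_notMem _ h2]
      ring

/-- If `γ = b * c⁻¹` with `b, c ∈ B`, then `b` and `c` have the same source, hence are equal and `γ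
= r b`. -/
theorem charFn_mul_charFn_inv {B : Set (Arr X)} (hB : IsCompactOpenBisection B) :
    charFn B ⟨hB.isCompact, hB.isOpen⟩ * charFn _ ⟨hB.inv.isCompact, hB.inv.isOpen⟩ =
      charFn (r '' B) (isCompact_isOpen_image_r ⟨hB.isCompact, hB.isOpen⟩) := by
  ext γ
  rw [ConvAlg.mul_apply]
  by_cases hγ : γ ∈ r '' B
  · obtain ⟨b, hb, rfl⟩ := hγ
    have h1 : b⁻¹ * r b = b⁻¹ := by rw [← d_inv b, mul_d]
    rw [conv_eq_single (a := b) (r_r b).symm fun c hc hne _ =>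
      hB.injOn_r (mem_of_charFn_ne_zero hne) hb hc, h1, charFn_of_mem _ hb,
      charFn_of_mem _ (mem_image_of_mem r hb), charFn_of_mem, mul_one]
    rw [mem_preimage, inv_inv']
    exact hb
  · rw [charFn_of_notMem _ hγ]
    refine conv_eq_zero fun b hb => ?_
    by_contra hne
    have hb1 : b ∈ B := mem_of_charFn_ne_zero (left_ne_zero_of_mul hne)
    have hb2 : (b⁻¹ * γ)⁻¹ ∈ B :=
      mem_of_charFn_ne_zero (B := (fun g => g⁻¹) ⁻¹' B) (right_ne_zero_of_mul hne)
    have h3 : (b⁻¹ * γ)⁻¹ = b := hB.injOn_d hb2 hb1 (by rw [d_inv, r_inv_mul hb])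
    have h4 : b⁻¹ * γ = b⁻¹ := by rw [← inv_inv' (b⁻¹ * γ), h3]
    refine hγ ⟨b, hb1, ?_⟩
    rw [r_eq b, ← h4, mul_inv_cancel_left' hb]

end Product

/-! ### Effectiveness: every nonzero ideal meets the functions on units. -/

section Effective

variable {X : Type u} [Groupoid.{v} X] [TopologicalSpace (Arr X)] [T2Space (Arr X)]
  [IsAmpleGroupoid X]

/-- By effectiveness, no nonempty open part of `B` consists of isotropy arrows. So if some arrow of
`B` has both ends in `V`, one of them has distinct ends, which can be separated. -/
theorem exists_subset_disjoint_bisection (he : IsEffective X) {B : Set (Arr X)}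
    (hB : IsCompactOpenBisection B) (hBu : Disjoint B (unitSpace X)) {V : Set (Arr X)}
    (hV : IsOpen V) (hne : V.Nonempty) :
    ∃ V' ⊆ V, IsOpen V' ∧ V'.Nonempty ∧ ∀ γ ∈ B, r γ ∈ V' → d γ ∉ V' := by
  by_cases hO : (B ∩ (r ⁻¹' V ∩ d ⁻¹' V)).Nonempty
  · have hOo : IsOpen (B ∩ (r ⁻¹' V ∩ d ⁻¹' V)) :=
      hB.isOpen.inter ((hV.preimage continuous_r).inter (hV.preimage continuous_d))
    obtain ⟨g, ⟨hgB, hgr, hgd⟩, hg⟩ : ∃ g ∈ B ∩ (r ⁻¹' V ∩ d ⁻¹' V), d g ≠ r g := by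
      by_contra! hcon
      obtain ⟨g, hg⟩ := hO
      have hgi : g ∈ interior (iso X) := interior_maximal hcon hOo hg
      rw [← show unitSpace X = interior (iso X) from he] at hgi
      exact disjoint_left.1 hBu hg.1 hgi
    obtain ⟨P, Q, hP, hQ, hgP, hgQ, hPQ⟩ := t2_separation hg.symm
    -- An arrow of `B` with range in this set is, by injectivity of `r` on `B`, the one with source
    -- in `Q`; its source therefore misses `P`.
    refine ⟨V ∩ (P ∩ r '' (B ∩ d ⁻¹' Q)), inter_subset_left,
      hV.inter (hP.inter (isOpenMap_r _ (hB.isOpen.inter (hQ.preimage continuous_d)))),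
      ⟨r g, hgr, hgP, g, ⟨hgB, hgQ⟩, rfl⟩, ?_⟩
    rintro γ hγ ⟨-, -, γ', ⟨hγ', hγQ⟩, hrr⟩ ⟨-, hdP, -⟩
    obtain rfl := hB.injOn_r hγ' hγ hrr
    exact disjoint_left.1 hPQ hdP hγQ
  · exact ⟨V, Subset.rfl, hV, hne, fun γ hγ h1 h2 => hO ⟨γ, hγ, h1, h2⟩⟩

/-- In an effective ample groupoid, a compact set of arrows without units disappears after
compressing to a small enough open set of units. -/
theorem exists_subset_disjoint_isCompact (he : IsEffective X) {K : Set (Arr X)}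
    (hK : IsCompact K) (hKu : Disjoint K (unitSpace X)) {V : Set (Arr X)}
    (hV : IsOpen V) (hne : V.Nonempty) :
    ∃ V' ⊆ V, IsOpen V' ∧ V'.Nonempty ∧ ∀ γ ∈ K, r γ ∈ V' → d γ ∉ V' := by
  -- `V` is quantified inside the induction predicate so that the shrinkings for two pieces of `K`
  -- can be performed in succession.
  refine hK.induction_on
    (p := fun s => ∀ V : Set (Arr X), IsOpen V → V.Nonempty →
      ∃ V' ⊆ V, IsOpen V' ∧ V'.Nonempty ∧ ∀ γ ∈ s, r γ ∈ V' → d γ ∉ V') ?_ ?_ ?_ ?_ V hV hne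
  · exact fun V hV hne => ⟨V, Subset.rfl, hV, hne, by simp⟩
  · intro s t hst ht V hV hne
    obtain ⟨V', h1, h2, h3, h4⟩ := ht V hV hne
    exact ⟨V', h1, h2, h3, fun γ hγ => h4 γ (hst hγ)⟩
  · intro s t hs ht V hV hne
    obtain ⟨V', h1, h2, h3, h4⟩ := hs V hV hne
    obtain ⟨V'', k1, k2, k3, k4⟩ := ht V' h2 h3
    refine ⟨V'', k1.trans h1, k2, k3, ?_⟩
    rintro γ (hγ | hγ) hr hd
    · exact h4 γ hγ (k1 hr) (k1 hd)
    · exact k4 γ hγ hr hd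
  · intro g hg
    obtain ⟨B, hB, hgB, hBu⟩ := exists_isCompactOpenBisection
      (isClosed_unitSpace (X := X)).isOpen_compl (disjoint_left.1 hKu hg)
    exact ⟨B, mem_nhdsWithin_of_mem_nhds (hB.isOpen.mem_nhds hgB), fun V hV hne =>
      exists_subset_disjoint_bisection he hB (disjoint_left.2 hBu) hV hne⟩

/-- A nonzero ideal in the convolution algebra of an effective ample groupoid contains the
characteristic function of a nonempty compact open set of units. -/
theorem exists_charFn_mem (he : IsEffective X) (I : TwoSidedIdeal (ConvAlg X)) {f : ConvAlg X}
    (hf : f ∈ I) (hf0 : f ≠ 0) :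
    ∃ (V : Set (Arr X)) (hV : IsCompact V ∧ IsOpen V), V ⊆ unitSpace X ∧ V.Nonempty ∧
      charFn V hV ∈ I := by
  obtain ⟨γ, hγ⟩ : ∃ γ, f γ ≠ 0 := by
    by_contra! h
    exact hf0 (ConvAlg.ext h)
  -- With `γ⁻¹ ∈ C`, the only factorization contributing to `f * 1_C` at `r γ` is `γ * γ⁻¹`, so its
  -- value there is `f γ`.
  obtain ⟨C, hC, hγC, -⟩ := exists_isCompactOpenBisection isOpen_univ (mem_univ γ⁻¹)
  set f' := f * charFn C ⟨hC.isCompact, hC.isOpen⟩ with hf'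
  have hf'I : f' ∈ I := I.mul_mem_right _ _ hf
  have hmul : ∀ b : Arr X, r b = r γ → b⁻¹ * r γ = b⁻¹ := fun b hb => by
    rw [← hb, ← d_inv b, mul_d]
  have hf'γ : f' (r γ) = f γ := by
    rw [hf', ConvAlg.mul_apply, conv_eq_single (a := γ) (r_r γ).symm, hmul γ rfl, charFn_of_mem _ hγC,
      mul_one]
    intro b hb _ hne
    rw [r_r] at hb
    rw [hmul b hb] at hne
    have := hC.injOn_d (mem_of_charFn_ne_zero hne) hγC hb
    rw [← inv_inv' b, this, inv_inv']
  have hV₀ : IsOpen (unitSpace X ∩ {g | f' g ≠ 0}) :=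
    isOpen_unitSpace.inter (isOpen_ne_fun f'.continuous continuous_const)
  obtain ⟨V₁, hV₁, hV₁o, ⟨u, hu⟩, hV₁K⟩ := exists_subset_disjoint_isCompact he
    (K := tsupport f' ∩ (unitSpace X)ᶜ)
    (f'.hasCompactSupport.isCompact.inter_right isOpen_unitSpace.isClosed_compl)
    (disjoint_left.2 fun _ h => h.2) hV₀
    ⟨r γ, r_mem_unitSpace γ, hf'γ.trans_ne hγ⟩
  obtain ⟨V, hV, huV, hVV₁⟩ := exists_isCompactOpenBisection hV₁o hu
  have hVc : IsCompact V ∧ IsOpen V := ⟨hV.isCompact, hV.isOpen⟩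
  have hVu : V ⊆ unitSpace X := fun v hv => (hV₁ (hVV₁ hv)).1
  have hV0 : ∀ v ∈ V, f' v ≠ 0 := fun v hv => (hV₁ (hVV₁ hv)).2
  refine ⟨V, hVc, hVu, ⟨u, huV⟩, ?_⟩
  have hφ : ContinuousOn (fun g => (f' g)⁻¹) V := f'.continuous.continuousOn.inv₀ hV0
  -- The cut-offs on the two sides leave only arrows with both ends in `V`; those in the support of
  -- `f'` are units, where the last factor inverts `f'`.
  have heq : charFn V hVc = charFn V hVc * f' * extendZero V hVc _ hφ := by
    ext g
    rw [mul_extendZero_apply hVc hφ hVu, charFn, extendZero_mul_apply hVc _ hVu, ← charFn]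
    by_cases hg : g ∈ V
    · rw [r_eq_self (hVu hg), d_eq_self (hVu hg), charFn_of_mem _ hg, indicator_of_mem hg,
        indicator_of_mem hg, one_mul, mul_inv_cancel₀ (hV0 g hg)]
    · rw [charFn_of_notMem _ hg]
      by_contra hne
      have h1 := left_ne_zero_of_mul (Ne.symm hne)
      have hd : d g ∈ V := mem_of_indicator_ne_zero (right_ne_zero_of_mul (Ne.symm hne))
      have hr : r g ∈ V := mem_of_indicator_ne_zero (left_ne_zero_of_mul h1)
      have hgu : g ∉ unitSpace X := fun h => hg (r_eq_self h ▸ hr)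
      exact hV₁K g ⟨subset_tsupport _ (right_ne_zero_of_mul h1), hgu⟩ (hVV₁ hr) (hVV₁ hd)
  rw [heq]
  exact I.mul_mem_right _ _ (I.mul_mem_left _ _ hf'I)

end Effective

/-! ### Minimality: an ideal containing functions on units is everything. -/

section Simple

variable {X : Type u} [Groupoid.{v} X] [TopologicalSpace (Arr X)] [T2Space (Arr X)]
  [IsAmpleGroupoid X]

/-- The units at which an ideal contains the characteristic function of a compact open
neighbourhood. -/
def unitsOfIdeal (I : TwoSidedIdeal (ConvAlg X)) : Set (unitSpace X) :=
  {u | ∃ (V : Set (Arr X)) (hV : IsCompact V ∧ IsOpen V), V ⊆ unitSpace X ∧ (u : Arr X) ∈ V ∧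
    charFn V hV ∈ I}

theorem isOpen_unitsOfIdeal (I : TwoSidedIdeal (ConvAlg X)) : IsOpen (unitsOfIdeal I) := by
  rw [isOpen_iff_mem_nhds]
  rintro u ⟨V, hV, hVu, huV, hI⟩
  exact Filter.mem_of_superset ((hV.2.preimage continuous_subtype_val).mem_nhds huV)
    fun w hw => ⟨V, hV, hVu, hw, hI⟩

/-- For a bisection `B` with sources in `V`, `1_B * 1_V * 1_{B⁻¹} = 1_{r(B)}`, so membership in `I`
is carried from the source of an arrow to its range. -/
theorem isInvariant_unitsOfIdeal (I : TwoSidedIdeal (ConvAlg X)) :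
    IsInvariant (unitsOfIdeal I) := by
  have key : ∀ g : Arr X, dMap g ∈ unitsOfIdeal I → rMap g ∈ unitsOfIdeal I := by
    rintro g ⟨V, hV, hVu, hgV, hI⟩
    obtain ⟨B, hB, hgB, hBV⟩ := exists_isCompactOpenBisection (hV.2.preimage continuous_d)
      (show g ∈ d ⁻¹' V from hgV)
    refine ⟨r '' B, isCompact_isOpen_image_r ⟨hB.isCompact, hB.isOpen⟩,
      image_r_subset_unitSpace B, mem_image_of_mem r hgB, ?_⟩
    rw [← charFn_mul_charFn_inv hB, ← mul_charFn_eq_self hV hVu (charFn B _) fun γ hγ =>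
      hBV (mem_of_charFn_ne_zero hγ)]
    exact I.mul_mem_right _ _ (I.mul_mem_left _ _ hI)
  exact fun g => ⟨key g, fun h => key g⁻¹ h⟩

/-- The ranges of the support of `f` form a compact set, covered by finitely many sets whose
characteristic functions lie in `I`; the characteristic function of their union is a left identity
for `f`. -/
theorem eq_top_of_unitsOfIdeal {I : TwoSidedIdeal (ConvAlg X)} (hI : unitsOfIdeal I = univ) :
    I = ⊤ := by
  refine eq_top_iff.2 fun f _ => ?_
  have hK : IsCompact (r '' tsupport f) := f.hasCompactSupport.isCompact.image continuous_r
  obtain ⟨V, hV, hVu, hKV, hVI⟩ : ∃ (V : Set (Arr X)) (hV : IsCompact V ∧ IsOpen V),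
      V ⊆ unitSpace X ∧ r '' tsupport f ⊆ V ∧ charFn V hV ∈ I := by
    refine hK.induction_on (p := fun s => ∃ (V : Set (Arr X)) (hV : IsCompact V ∧ IsOpen V),
      V ⊆ unitSpace X ∧ s ⊆ V ∧ charFn V hV ∈ I) ?_ ?_ ?_ ?_
    · refine ⟨∅, ⟨isCompact_empty, isOpen_empty⟩, empty_subset _, Subset.rfl, ?_⟩
      convert I.zero_mem
      ext γ
      exact charFn_of_notMem _ (notMem_empty γ)
    · rintro s t hst ⟨V, hV, hVu, htV, hVI⟩
      exact ⟨V, hV, hVu, hst.trans htV, hVI⟩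
    · rintro s t ⟨U, hU, hUu, hsU, hUI⟩ ⟨V, hV, hVu, htV, hVI⟩
      refine ⟨U ∪ V, ⟨hU.1.union hV.1, hU.2.union hV.2⟩, union_subset hUu hVu,
        union_subset_union hsU htV, ?_⟩
      rw [charFn_union hU hV hUu hVu, ← ConvAlg.mul_smul]
      exact I.add_mem hUI (I.add_mem hVI (I.mul_mem_right _ _ hUI))
    · rintro _ ⟨g, -, rfl⟩
      obtain ⟨V, hV, hVu, hgV, hVI⟩ : rMap g ∈ unitsOfIdeal I := hI ▸ mem_univ _
      exact ⟨V, mem_nhdsWithin_of_mem_nhds (hV.2.mem_nhds hgV), V, hV, hVu, Subset.rfl, hVI⟩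
  rw [← charFn_mul_eq_self hV hVu f fun γ hγ => hKV (mem_image_of_mem r (subset_tsupport _ hγ))]
  exact I.mul_mem_right _ _ hVI

theorem isSimpleRing_of_isMinimal_of_isEffective [Nonempty X] (hm : IsMinimal X)
    (he : IsEffective X) : IsSimpleRing (ConvAlg X) := by
  obtain ⟨x⟩ := ‹Nonempty X›
  obtain ⟨B, hB, hxB, -⟩ := exists_isCompactOpenBisection isOpen_univ
    (mem_univ (⟨x, x, 𝟙 x⟩ : Arr X))
  have hne := charFn_ne_zero ⟨hB.isCompact, hB.isOpen⟩ hxB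
  have hbt : (⊥ : TwoSidedIdeal (ConvAlg X)) ≠ ⊤ := by
    intro h
    refine hne ((TwoSidedIdeal.mem_bot _).1 ?_)
    rw [h]
    trivial
  refine ⟨{ exists_pair_ne := ⟨⊥, ⊤, hbt⟩, eq_bot_or_eq_top := fun I => ?_ }⟩
  by_cases hI : ∃ f ∈ I, f ≠ 0
  · obtain ⟨f, hf, hf0⟩ := hI
    obtain ⟨V, hV, hVu, ⟨w, hw⟩, hVI⟩ := exists_charFn_mem he I hf hf0
    refine Or.inr (eq_top_of_unitsOfIdeal ?_)
    refine (hm _ (isOpen_unitsOfIdeal I) (isInvariant_unitsOfIdeal I)).resolve_left ?_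
    exact Set.Nonempty.ne_empty ⟨⟨w, hVu hw⟩, V, hV, hVu, hw, hVI⟩
  · push Not at hI
    exact Or.inl (eq_bot_iff.2 fun f hf => (TwoSidedIdeal.mem_bot _).2 (hI f hf))

end Simple

/-! ### Ideals from invariant sets and from the action on the unit space. -/

section Ideals

variable {X : Type u} [Groupoid.{v} X] [TopologicalSpace (Arr X)] [T2Space (Arr X)]
  [IsEtaleGroupoid X]

/-- The ideal of functions that vanish on all arrows with range outside an invariant set. -/
noncomputable def idealOfInvariant (U : Set (unitSpace X)) (hU : IsInvariant U) :
    TwoSidedIdeal (ConvAlg X) :=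
  TwoSidedIdeal.mk' {f | ∀ γ, rMap γ ∉ U → f γ = 0}
    (fun _ _ => rfl)
    (fun {f g} hf hg γ hγ => by rw [ConvAlg.add_apply, hf γ hγ, hg γ hγ, add_zero])
    (fun {f} hf γ hγ => by rw [neg_apply, hf γ hγ, neg_zero])
    (fun {f g} hg γ hγ => by
      rw [ConvAlg.mul_apply]
      refine conv_eq_zero fun a ha => ?_
      -- The right factor has range `d a`, which by invariance lies outside `U` together with `r a =
      -- r γ`.
      rw [hg, mul_zero]
      have h : rMap (a⁻¹ * γ) = dMap a := Subtype.ext (r_inv_mul ha)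
      rwa [h, hU a, rMap_eq_iff.2 ha])
    (fun {f g} hf γ hγ => by
      rw [ConvAlg.mul_apply]
      refine conv_eq_zero fun a ha => ?_
      rw [hf a (by rwa [rMap_eq_iff.2 ha]), zero_mul])

theorem mem_idealOfInvariant {U : Set (unitSpace X)} {hU : IsInvariant U} {f : ConvAlg X} :
    f ∈ idealOfInvariant U hU ↔ ∀ γ, rMap γ ∉ U → f γ = 0 :=
  TwoSidedIdeal.mem_mk' ..

/-- Here `h` need be neither continuous nor compactly supported, so ring distributivity does not
apply; the sums are finite because of the supports of `f` and `g`. -/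
theorem conv_add_left (f g : ConvAlg X) (h : Arr X → ℂ) :
    conv (f + g : ConvAlg X) h = conv f h + conv g h := by
  classical
  ext γ
  obtain ⟨S, hS, hf⟩ := ConvAlg.finite_left f γ
  obtain ⟨T, hT, hg⟩ := ConvAlg.finite_left g γ
  have hST : ∀ a ∈ S ∪ T, r a = r γ := fun a ha =>
    (Finset.mem_union.1 ha).elim (hS a) (hT a)
  rw [Pi.add_apply, conv_eq_sum_left f h _ hST
      fun a ha hne => Finset.mem_union_left _ (hf a ha hne),
    conv_eq_sum_left g h _ hST fun a ha hne => Finset.mem_union_right _ (hg a ha hne),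
    conv_eq_sum_left (f + g) h _ hST, ← Finset.sum_add_distrib]
  · simp only [ConvAlg.add_apply, add_mul]
  · intro a ha hne
    by_contra hcon
    rw [Finset.mem_union, not_or] at hcon
    refine hne ?_
    rw [ConvAlg.add_apply, not_not.1 (mt (hf a ha) hcon.1), not_not.1 (mt (hg a ha) hcon.2),
      add_zero]

theorem conv_neg_left (f : ConvAlg X) (h : Arr X → ℂ) :
    conv (-f : ConvAlg X) h = -conv f h := by
  have h1 := conv_add_left f (-f) h
  rw [add_neg_cancel] at h1
  have h0 : conv (0 : ConvAlg X) h = 0 := funext fun γ => conv_eq_zero fun b _ => zero_mul _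
  rw [h0] at h1
  exact eq_neg_of_add_eq_zero_right h1.symm

/-- Associativity of convolution with an arbitrary function as third factor. -/
theorem conv_mul_left (f g : ConvAlg X) (h : Arr X → ℂ) :
    conv (f * g : ConvAlg X) h = conv f (conv g h) := by
  classical
  ext γ
  obtain ⟨S, hS, hf⟩ := ConvAlg.finite_left f γ
  choose T hT hg using ConvAlg.finite_left g
  -- `R` consists of the products `b * c` with `b` from the support of `f` and `c` from that of `g`;
  -- it contains every arrow over `r γ` where `f * g` is nonzero.
  set R : Finset (Arr X) := S.biUnion fun b => (T (b⁻¹ * γ)).image fun c => b * c with hR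
  have hbc : ∀ b ∈ S, ∀ c, r c = r (b⁻¹ * γ) → d b = r c := fun b hb c hc => by
    rw [hc, r_inv_mul (hS b hb)]
  have hRr : ∀ a ∈ R, r a = r γ := by
    intro a ha
    obtain ⟨b, hb, ha⟩ := Finset.mem_biUnion.1 ha
    obtain ⟨c, hc, rfl⟩ := Finset.mem_image.1 ha
    rw [r_mul (hbc b hb c (hT _ c hc)), hS b hb]
  have hmemR : ∀ b ∈ S, ∀ a, r a = r γ → g (b⁻¹ * a) ≠ 0 → a ∈ R := by
    intro b hb a ha hne
    have hba : r b = r a := (hS b hb).trans ha.symm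
    refine Finset.mem_biUnion.2 ⟨b, hb, Finset.mem_image.2 ⟨b⁻¹ * a, hg _ _ ?_ hne,
      mul_inv_cancel_left' hba⟩⟩
    rw [r_inv_mul hba, r_inv_mul (hS b hb)]
  have hfg : ∀ a, r a = r γ → (f * g) a = ∑ b ∈ S, f b * g (b⁻¹ * a) := fun a ha =>
    ConvAlg.mul_apply_eq_sum f g a S (fun b hb => (hS b hb).trans ha.symm)
      (fun b hb hne => hf b (hb.trans ha) hne)
  rw [conv_eq_sum_left (f * g) h R hRr, conv_eq_sum_left f _ S hS hf]
  · rw [Finset.sum_congr rfl fun a ha => by rw [hfg a (hRr a ha), Finset.sum_mul], Finset.sum_comm]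
    refine Finset.sum_congr rfl fun b hb => ?_
    have hbγ := hS b hb
    rw [conv_eq_sum_left g h (R.image fun a => b⁻¹ * a), Finset.sum_image, Finset.mul_sum]
    · refine Finset.sum_congr rfl fun a ha => ?_
      have hba : r b = r a := hbγ.trans (hRr a ha).symm
      rw [mul_inv_rev' (by rwa [d_inv]), inv_inv', mul_assoc' (by rw [d_inv, hba])
        (by rw [r_inv_mul hbγ]), mul_inv_cancel_left' hbγ, mul_assoc]
    · intro a ha a' ha' haa
      have hba : r b = r a := hbγ.trans (hRr a ha).symm
      have hba' : r b = r a' := hbγ.trans (hRr a' ha').symm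
      have haa' : b⁻¹ * a = b⁻¹ * a' := haa
      rw [← mul_inv_cancel_left' hba, haa', mul_inv_cancel_left' hba']
    · intro c hc
      obtain ⟨a, ha, rfl⟩ := Finset.mem_image.1 hc
      rw [r_inv_mul (hbγ.trans (hRr a ha).symm), r_inv_mul hbγ]
    · intro c hc hne
      have hdc : d b = r c := hbc b hb c hc
      refine Finset.mem_image.2 ⟨b * c, hmemR b hb _ ?_ ?_, inv_mul_cancel_left' hdc⟩
      · rw [r_mul hdc, hbγ]
      · rwa [inv_mul_cancel_left' hdc]
  · intro a ha hne
    rw [hfg a ha] at hne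
    obtain ⟨b, hb, hne⟩ := Finset.exists_ne_zero_of_sum_ne_zero hne
    exact hmemR b hb a ha (right_ne_zero_of_mul hne)

/-- Since `h` depends only on the range, the value at `γ` is the sum of `f a * h (d a)` over `r a =
r γ`, which involves only `r γ`. -/
theorem conv_apply_r (f : ConvAlg X) {h : Arr X → ℂ} (hh : ∀ γ, h (r γ) = h γ) (γ : Arr X) :
    conv f h (r γ) = conv f h γ := by
  obtain ⟨S, hS, hf⟩ := ConvAlg.finite_left f γ
  rw [conv_eq_sum_left f h S hS hf, conv_eq_sum_left (γ := r γ) f h S hS hf]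
  refine Finset.sum_congr rfl fun a ha => ?_
  rw [← hh, ← hh (a⁻¹ * γ), r_inv_mul (hS a ha), r_inv_mul (b := r γ) (hS a ha)]

variable (X) in
/-- The kernel of the representation of the convolution algebra on functions on the unit space
(identified with the functions on arrows that depend only on the range). -/
noncomputable def augmentationIdeal : TwoSidedIdeal (ConvAlg X) :=
  TwoSidedIdeal.mk' {f | ∀ h : Arr X → ℂ, (∀ γ, h (r γ) = h γ) → conv f h = 0}
    (fun _ _ => funext fun γ => conv_eq_zero fun b _ => zero_mul _)
    (fun {f g} hf hg h hh => by rw [conv_add_left, hf h hh, hg h hh, add_zero])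
    (fun {f} hf h hh => by rw [conv_neg_left, hf h hh, neg_zero])
    (fun {f g} hg h hh => by
      rw [conv_mul_left, hg h hh]
      exact funext fun γ => conv_eq_zero fun b _ => mul_zero _)
    (fun {f g} hf h hh => by
      rw [conv_mul_left]
      exact hf _ (conv_apply_r g hh))

theorem mem_augmentationIdeal {f : ConvAlg X} :
    f ∈ augmentationIdeal X ↔ ∀ h : Arr X → ℂ, (∀ γ, h (r γ) = h γ) → conv f h = 0 :=
  TwoSidedIdeal.mem_mk' ..

/-- At the range of `b ∈ B`, `1_B` produces `h (d b)` and `1_{r(B)}` produces `h (r b)`; these agree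
on isotropy. Away from `r(B)` both give zero. -/
theorem charFn_add_neg_charFn_mem_augmentationIdeal {B : Set (Arr X)}
    (hB : IsCompactOpenBisection B) (hiso : B ⊆ iso X) :
    charFn B ⟨hB.isCompact, hB.isOpen⟩ +
      -charFn (r '' B) (isCompact_isOpen_image_r ⟨hB.isCompact, hB.isOpen⟩) ∈
        augmentationIdeal X := by
  rw [mem_augmentationIdeal]
  intro h hh
  rw [conv_add_left, conv_neg_left, ← sub_eq_add_neg, sub_eq_zero]
  ext γ
  have hinj : InjOn r (r '' B) := by
    rintro _ ⟨a, -, rfl⟩ _ ⟨b, -, rfl⟩ hab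
    exact hab
  by_cases hγ : ∃ b ∈ B, r b = r γ
  · obtain ⟨b, hb, hbγ⟩ := hγ
    rw [conv_charFn _ hB.injOn_r hh hb hbγ,
      conv_charFn _ hinj hh (mem_image_of_mem r hb) hbγ, d_r, show d b = r b from hiso hb]
  · push Not at hγ
    rw [conv_eq_zero, conv_eq_zero]
    · intro c hc
      rw [charFn_of_notMem, zero_mul]
      rintro ⟨b, hb, rfl⟩
      exact hγ b hb hc
    · intro c hc
      rw [charFn_of_notMem _ fun hcB => hγ c hcB hc, zero_mul]

theorem eq_top_of_mem_ne_zero [IsSimpleRing (ConvAlg X)] {I : TwoSidedIdeal (ConvAlg X)}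
    {f : ConvAlg X} (hf : f ∈ I) (hf0 : f ≠ 0) : I = ⊤ := by
  refine (IsSimpleRing.simple.eq_bot_or_eq_top I).resolve_left ?_
  rintro rfl
  exact hf0 ((TwoSidedIdeal.mem_bot _).1 hf)

end Ideals

/-! ### Simplicity forces minimality and effectiveness. -/

section Converse

variable {X : Type u} [Groupoid.{v} X] [TopologicalSpace (Arr X)] [T2Space (Arr X)]
  [IsAmpleGroupoid X]

theorem isMinimal_of_isSimpleRing (hs : IsSimpleRing (ConvAlg X)) : IsMinimal X := by
  intro U hU hinv
  by_contra! hcon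
  obtain ⟨⟨u, hu⟩, hne⟩ := hcon
  obtain ⟨w, hw⟩ := (ne_univ_iff_exists_notMem U).1 hne
  obtain ⟨V, hV, huV, hVU⟩ := exists_isCompactOpenBisection
    (isOpen_unitSpace.isOpenMap_subtype_val U hU) (mem_image_of_mem Subtype.val hu)
  have hVc : IsCompact V ∧ IsOpen V := ⟨hV.isCompact, hV.isOpen⟩
  have hmem : charFn V hVc ∈ idealOfInvariant U hinv := by
    refine mem_idealOfInvariant.2 fun γ hγ => charFn_of_notMem _ fun hγV => hγ ?_
    obtain ⟨γ', h1, rfl⟩ := hVU hγV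
    rwa [show rMap (γ' : Arr X) = γ' from Subtype.ext (r_eq_self γ'.2)]
  have htop := eq_top_of_mem_ne_zero hmem (charFn_ne_zero hVc huV)
  obtain ⟨C, hC, hwC, -⟩ := exists_isCompactOpenBisection isOpen_univ (mem_univ (w : Arr X))
  have hCc : IsCompact C ∧ IsOpen C := ⟨hC.isCompact, hC.isOpen⟩
  have hCmem : charFn C hCc ∈ idealOfInvariant U hinv := by
    rw [htop]
    trivial
  have h0 := mem_idealOfInvariant.1 hCmem w
    (by rwa [show rMap (w : Arr X) = w from Subtype.ext (r_eq_self w.2)])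
  rw [charFn_of_mem _ hwC] at h0
  exact one_ne_zero h0

theorem isEffective_of_isSimpleRing (hs : IsSimpleRing (ConvAlg X)) : IsEffective X := by
  refine Subset.antisymm (interior_maximal ?_ isOpen_unitSpace) fun g hg => ?_
  · rintro _ ⟨a, rfl⟩
    rfl
  by_contra hgu
  -- The unit space is closed because the arrow space is Hausdorff, so removing it from the interior
  -- of the isotropy leaves an open set.
  obtain ⟨B, hB, hgB, hBsub⟩ := exists_isCompactOpenBisection
    (isOpen_interior.inter (isClosed_unitSpace (X := X)).isOpen_compl) ⟨hg, hgu⟩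
  have hmem := charFn_add_neg_charFn_mem_augmentationIdeal hB
    fun b hb => interior_subset (hBsub hb).1
  have hrB := isCompact_isOpen_image_r ⟨hB.isCompact, hB.isOpen⟩
  have htop := eq_top_of_mem_ne_zero hmem (by
    intro h0
    have h1 := DFunLike.congr_fun h0 g
    rw [ConvAlg.add_apply, neg_apply, charFn_of_mem _ hgB,
      charFn_of_notMem _ fun h => hgu (image_r_subset_unitSpace B h), neg_zero, add_zero] at h1
    exact one_ne_zero h1)
  have hrmem : charFn (r '' B) hrB ∈ augmentationIdeal X := by
    rw [htop]
    trivial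
  have hinj : InjOn r (r '' B) := by
    rintro _ ⟨a, -, rfl⟩ _ ⟨b, -, rfl⟩ hab
    exact hab
  -- The constant function `1` shows that the kernel is proper: `1_{r(B)}` sends it to a function
  -- with value `1` at `g`.
  have h1 := congrFun (mem_augmentationIdeal.1 hrmem (fun _ => 1) fun _ => rfl) g
  rw [conv_charFn hrB hinj (fun _ => rfl) (mem_image_of_mem r hgB) (r_r g)] at h1
  exact one_ne_zero h1

end Converse

end AmpleGroupoid

/-- Let `X` be the object set of an ample Hausdorff groupoid (with at least one object). The complex
convolution ring `C_c(𝒢)` is simple (it has exactly two two-sided ideals) if and only if the groupoid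
is minimal and effective. -/
theorem mainTheorem6 (X : Type*) [Nonempty X] [CategoryTheory.Groupoid X]
    [TopologicalSpace (AmpleGroupoid.Arr X)] [AmpleGroupoid.IsAmpleGroupoid X]
    [T2Space (AmpleGroupoid.Arr X)] :
    IsSimpleRing (AmpleGroupoid.ConvAlg X) ↔
      AmpleGroupoid.IsMinimal X ∧ AmpleGroupoid.IsEffective X :=
  ⟨fun h => ⟨AmpleGroupoid.isMinimal_of_isSimpleRing h,
    AmpleGroupoid.isEffective_of_isSimpleRing h⟩,
    fun h => AmpleGroupoid.isSimpleRing_of_isMinimal_of_isEffective h.1 h.2⟩
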